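/- Let $p$ be a prime, let $Q$ be a non-cyclic finite $p$-group, and let $A \neq 0$ be a $Q$-module (an abelian group on which $Q$ acts by additive automorphisms) whose underlying group is a finite $p$-group. If $A$ can be generated by $p-2$ elements as an abelian group, then $A$ is not cohomologically trivial; that is, the Tate cohomology groups $\hat{H}^n(S,A)$ do not all vanish as $S$ ranges over the subgroups of $Q$ and $n$ over $\mathbb{Z}$. -/

import Mathlib

/-- Let `Q` be a finite group and `A` a `Q`-module (an abelian group with an additive action of
`Q`). The module `A` is cohomologically trivial if the Tate cohomology groups `Ĥⁿ(S, A)` vanish for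
all subgroups `S ≤ Q` and all integers `n`. Here `A` is regarded, by restriction of the action, as a
representation of `S` over `ℤ`. The finiteness structure on `S` is only the datum that the Tate norm
`a ↦ ∑ s : S, s • a` needs; it exists and is unique because `Q` is finite. -/
def IsCohomologicallyTrivial (Q : Type) [Group Q] [Finite Q]
    (A : Type) [AddCommGroup A] [DistribMulAction Q A] : Prop :=
  ∀ (S : Subgroup Q) [Fintype S] (n : ℤ),
    Subsingleton (tateCohomology (Rep.ofDistribMulAction ℤ S A) n)

/-! Degree zero suffices: every invariant of a subgroup is a norm. Let g have order p. It acts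
unipotently on A/pA, of dimension at most p - 2, so (g - 1)^(p-2) maps A into pA. The norm of g is
(g - 1)^(p-1) + p(1 + (g - 1)w), which is p up to a nilpotent correction, so its image is pA. Hence
A^g = pA for every g of order p (`NormsSurjectOntoInvariants.apply_eq_self_iff`). Induct on the
order of the group G. For a central C of order p, B = A^C = pA is nonzero, inherits the generator
bound and the norm property over G/C, so G/C is cyclic. If G were not cyclic, some g of order p
would lie outside C. It fixes A^g = pA = B pointwise, while its image in G/C has order p and fixes
only pB. So B = pB, forcing B = 0. -/

/-! ### Norms of operators of order p -/

open Polynomial in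
/-- The `p`-th geometric sum, expanded around `X = 1`. -/
theorem exists_geom_sum_X_eq (p : ℕ) [hp : Fact p.Prime] :
    ∃ w : ℤ[X], ∑ i ∈ Finset.range p, (X : ℤ[X]) ^ i =
      (X - 1) ^ (p - 1) + (p : ℤ[X]) * (1 + (X - 1) * w) := by
  obtain ⟨n, rfl⟩ : ∃ n, p = n + 2 := ⟨p - 2, by have := hp.out.two_le; omega⟩
  have key : ∃ w : ℤ[X], ∑ i ∈ Finset.range (n + 2), ((n + 2).choose (i + 1) : ℤ[X]) * X ^ i =
      X ^ (n + 1) + ((n + 2 : ℕ) : ℤ[X]) * (1 + X * w) := by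
    refine ⟨∑ i ∈ Finset.range n, (((n + 2).choose (i + 2) / (n + 2) : ℕ) : ℤ[X]) * X ^ i, ?_⟩
    rw [Finset.sum_range_succ, Finset.sum_range_succ', Nat.choose_self, mul_add, Finset.mul_sum,
      Finset.mul_sum]
    have : ∀ i ∈ Finset.range n, ((n + 2).choose (i + 1 + 1) : ℤ[X]) * X ^ (i + 1) =
        ((n + 2 : ℕ) : ℤ[X]) * (X * ((((n + 2).choose (i + 2) / (n + 2) : ℕ) : ℤ[X]) * X ^ i)) := by
      intro i hi
      have hd : (n + 2) ∣ (n + 2).choose (i + 2) :=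
        hp.out.dvd_choose_self (by omega) (by have := Finset.mem_range.1 hi; omega)
      obtain ⟨c, hc⟩ := hd
      rw [show i + 1 + 1 = i + 2 from rfl, hc, Nat.mul_div_cancel_left _ (by omega)]
      push_cast
      ring
    rw [Finset.sum_congr rfl this]
    simp
    ring
  obtain ⟨w, hw⟩ := key
  refine ⟨w.comp (X - 1), ?_⟩
  have h2 := congr_arg (fun q : ℤ[X] => q.comp (X - 1))
    ((Polynomial.geom_sum_X_comp_X_add_one_eq_sum (R := ℤ) (n + 2)).trans
      ((Finset.sum_congr rfl fun i _ => by simp).trans hw))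
  simpa [Polynomial.comp_assoc] using h2

/-- If `A` is generated by `n` elements and `g` is an automorphism of `A` with `g ^ p = 1`, then
`(g - 1) ^ n` maps `A` into `p • A`. -/
theorem exists_sub_one_pow_apply_eq_nsmul {p n : ℕ} [hp : Fact p.Prime] {A : Type*} [AddCommGroup A]
    (hgen : ∃ s : Finset A, s.card ≤ n ∧ AddSubgroup.closure (s : Set A) = ⊤)
    {g : Module.End ℤ A} (hg : g ^ p = 1) (a : A) :
    ∃ b, ((g - 1) ^ n) a = p • b := by
  obtain ⟨s, hs, hsg⟩ := hgen
  let H : AddSubgroup A := (nsmulAddMonoidHom (α := A) p).range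
  obtain ⟨_⟩ : Nonempty (Module (ZMod p) (A ⧸ H)) :=
    ⟨QuotientAddGroup.zmodModule fun x => ⟨x, rfl⟩⟩
  have hle (f : Module.End ℤ A) : H ≤ H.comap f.toAddMonoidHom := by
    rintro _ ⟨y, rfl⟩
    exact ⟨f y, by simp⟩
  let Φ (f : Module.End ℤ A) : (A ⧸ H) →ₗ[ZMod p] (A ⧸ H) :=
    (QuotientAddGroup.map H H f.toAddMonoidHom (hle f)).toZModLinearMap p
  have hΦ (f : Module.End ℤ A) (a : A) : Φ f (a : A ⧸ H) = (f a : A) := rfl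
  have hΦpow (f : Module.End ℤ A) (k : ℕ) (a : A) : (Φ f ^ k : Module.End (ZMod p) (A ⧸ H)) (a : A ⧸ H) = ((f ^ k) a : A) := by
    induction k with
    | zero => rfl
    | succ k ih => rw [pow_succ', Module.End.mul_apply, ih, hΦ, pow_succ', Module.End.mul_apply]
  have hspan : Submodule.span (ZMod p) ((QuotientAddGroup.mk' H) '' (s : Set A)) = ⊤ := by
    rw [eq_top_iff]
    rintro x -
    obtain ⟨a, rfl⟩ := QuotientAddGroup.mk'_surjective H x
    have ha : a ∈ AddSubgroup.closure (s : Set A) := hsg ▸ AddSubgroup.mem_top a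
    have := AddSubgroup.mem_map_of_mem (QuotientAddGroup.mk' H) ha
    rw [AddMonoidHom.map_closure] at this
    exact (AddSubgroup.closure_le (K := (Submodule.span (ZMod p) _).toAddSubgroup)).2
      Submodule.subset_span this
  have : Module.Finite (ZMod p) (A ⧸ H) := ⟨Submodule.fg_def.2 ⟨_, s.finite_toSet.image _, hspan⟩⟩
  have hrank : Module.finrank (ZMod p) (A ⧸ H) ≤ n := by
    classical
    have h1 := finrank_span_finset_le_card (R := ZMod p) (s.image (QuotientAddGroup.mk' H))
    rw [Finset.coe_image, Set.finrank, hspan, finrank_top] at h1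
    exact h1.trans (Finset.card_image_le.trans hs)
  have hsub : Φ (g - 1) = Φ g - 1 := by
    ext x
    obtain ⟨a, rfl⟩ := QuotientAddGroup.mk'_surjective H x
    rfl
  -- Frobenius in characteristic p: (g - 1)^p = g^p - 1 = 0 on A/pA.
  have hnil : (Φ (g - 1)) ^ p = 0 := by
    have h1 : (Polynomial.X - 1 : Polynomial (ZMod p)) ^ p = Polynomial.X ^ p - 1 := by
      rw [sub_pow_char, one_pow]
    have h2 := congr_arg (Polynomial.aeval (Φ g)) h1
    have h3 : Φ g ^ p = 1 := by
      ext x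
      obtain ⟨a, rfl⟩ := QuotientAddGroup.mk'_surjective H x
      exact (hΦpow g p a).trans (by rw [hg]; rfl)
    rw [hsub]
    simpa [h3] using h2
  have hz : Φ (g - 1) ^ n = 0 := by
    have h1 := LinearMap.aeval_self_charpoly (Φ (g - 1))
    rw [IsNilpotent.charpoly_eq_X_pow_finrank ⟨p, hnil⟩] at h1
    exact pow_eq_zero_of_le hrank (by simpa using h1)
  have h1 := hΦpow (g - 1) n a
  rw [hz] at h1
  obtain ⟨b, hb⟩ := (QuotientAddGroup.eq_zero_iff _).1 h1.symm
  exact ⟨b, hb.symm⟩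

theorem exists_pow_nsmul_eq_zero {p : ℕ} [Fact p.Prime] {A : Type*} [AddCommGroup A] [Finite A]
    (hA : IsPGroup p (Multiplicative A)) : ∃ m, ∀ a : A, p ^ m • a = 0 := by
  obtain ⟨m, hm⟩ := IsPGroup.iff_card.1 hA
  refine ⟨m, fun a => ?_⟩
  rw [← hm]
  exact card_nsmul_eq_zero' (x := a)

/-- On a finite abelian `p`-group, an endomorphism with values in `p • A` is nilpotent. -/
theorem isNilpotent_of_forall_eq_nsmul {p : ℕ} [Fact p.Prime] {A : Type*} [AddCommGroup A]
    [Finite A] (hA : IsPGroup p (Multiplicative A)) {f : Module.End ℤ A}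
    (hf : ∀ a, ∃ b, f a = p • b) : IsNilpotent f := by
  obtain ⟨m, hm⟩ := exists_pow_nsmul_eq_zero hA
  have key (k : ℕ) (a : A) : ∃ b, (f ^ k) a = p ^ k • b := by
    induction k with
    | zero => exact ⟨a, by simp⟩
    | succ k ih =>
      obtain ⟨b, hb⟩ := ih
      obtain ⟨c, hc⟩ := hf b
      exact ⟨c, by rw [pow_succ', Module.End.mul_apply, hb, map_nsmul, hc, smul_smul, pow_succ]⟩
  refine ⟨m, LinearMap.ext fun a => ?_⟩
  obtain ⟨b, hb⟩ := key m a
  rw [hb, hm, LinearMap.zero_apply]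

/-- If a finite abelian `p`-group `A` is generated by `p - 2` elements and `g ^ p = 1`, then the
norm `1 + g + ⋯ + g ^ (p - 1)` has image `p • A`. -/
theorem exists_geom_sum_apply_eq_iff {p : ℕ} [hp : Fact p.Prime] {A : Type*} [AddCommGroup A]
    [Finite A] (hA : IsPGroup p (Multiplicative A)) (h3 : 3 ≤ p)
    (hgen : ∃ s : Finset A, s.card ≤ p - 2 ∧ AddSubgroup.closure (s : Set A) = ⊤)
    {g : Module.End ℤ A} (hg : g ^ p = 1) (a : A) :
    (∃ b, (∑ i ∈ Finset.range p, g ^ i) b = a) ↔ ∃ b, p • b = a := by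
  obtain ⟨W, hW⟩ := exists_geom_sum_X_eq p
  have hx := exists_sub_one_pow_apply_eq_nsmul hgen hg
  have hp2 : p - 1 = (p - 2) + 1 := by omega
  obtain ⟨K, hK⟩ : IsNilpotent (g - 1) :=
    (isNilpotent_of_forall_eq_nsmul hA hx).of_pow
  set x := g - 1 with hxdef
  set N := ∑ i ∈ Finset.range p, g ^ i with hN
  set w := Polynomial.aeval g W
  have hNx : Commute x N :=
    Commute.sum_right _ _ _ fun i _ => ((Commute.refl g).sub_left (Commute.one_left g)).pow_right i
  have hNw : N = x ^ (p - 1) + (p : Module.End ℤ A) * (1 + x * w) := by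
    simpa using congr_arg (Polynomial.aeval g) hW
  -- Write x^(p-1) = x * x^(p-2); the second factor already lands in pA.
  have hNa (c : A) : ∃ d, N c = p • (c + x d) := by
    obtain ⟨b, hb⟩ := hx c
    refine ⟨b + w c, ?_⟩
    rw [hNw, hp2, pow_succ']
    simp [hb, Module.End.mul_apply, smul_add]
    abel
  constructor
  · rintro ⟨b, rfl⟩
    obtain ⟨d, hd⟩ := hNa b
    exact ⟨_, hd.symm⟩
  · rintro ⟨b, rfl⟩
    -- Substituting p c = N c - x(p d) repeatedly pushes the error into higher powers of the
    -- nilpotent x.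
    have key (k : ℕ) (a : A) : ∃ b c, p • a = N b + (x ^ k) (p • c) := by
      induction k with
      | zero => exact ⟨0, a, by simp⟩
      | succ k ih =>
        obtain ⟨b, c, h⟩ := ih
        obtain ⟨d, hd⟩ := hNa c
        refine ⟨b + (x ^ k) c, -d, ?_⟩
        have h1 : N ((x ^ k) c) = (x ^ k) (N c) :=
          (LinearMap.congr_fun (hNx.pow_left k).eq c).symm
        rw [h, map_add, h1, hd, pow_succ, Module.End.mul_apply]
        simp [smul_add]
        abel
    obtain ⟨b', c, h⟩ := key K b
    exact ⟨b', by rw [h, hK]; simp⟩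

/-! ### Invariants as norms -/

/-- The degree zero Tate cohomology of every subgroup vanishes: for every subgroup `S`, each vector
fixed by `S` is a norm from `S`. -/
def NormsSurjectOntoInvariants {G A : Type*} [Group G] [AddCommGroup A]
    (ρ : Representation ℤ G A) : Prop :=
  ∀ (S : Subgroup G) [Fintype S] (a : A), (∀ s ∈ S, ρ s a = a) → ∃ b, ∑ s : S, ρ s b = a

open CategoryTheory in
/-- If the Tate cohomology of `M` vanishes in degree zero, each invariant of `M` is a norm. -/
theorem exists_norm_apply_eq_of_subsingleton_tateCohomology_zero {R G : Type} [CommRing R]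
    [Group G] [Fintype G] (M : Rep R G) [h : Subsingleton (tateCohomology M 0)] {a : M}
    (ha : ∀ g, M.ρ g a = a) : ∃ b : M, M.ρ.norm b = a := by
  have hex : ((tateComplex M).sc' (-1) 0 1).Exact := by
    rw [← HomologicalComplex.exactAt_iff' _ _ _ _ (by simp) (by simp),
      HomologicalComplex.exactAt_iff_isZero_homology]
    exact @ModuleCat.isZero_of_subsingleton _ _ _ h
  have h0 : groupCohomology.d₀₁ M a = 0 := by
    ext g
    exact sub_eq_zero.2 (ha g)
  have hd : (groupCohomology.inhomogeneousCochains M).d 0 1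
      ((groupCohomology.cochainsIso₀ M).inv a) = 0 := by
    have := ConcreteCategory.congr_hom (groupCohomology.eq_d₀₁_comp_inv M) a
    rw [ModuleCat.comp_apply, ModuleCat.comp_apply, h0] at this
    exact this.trans (map_zero (groupCohomology.cochainsIso₁ M).inv.hom)
  obtain ⟨y, hy⟩ : ∃ y : (groupHomology.inhomogeneousChains M).X 0,
      M.tateNorm y = (groupCohomology.cochainsIso₀ M).inv a :=
    (ShortComplex.moduleCat_exact_iff _).1 hex _ hd
  refine ⟨(groupHomology.chainsIso₀ M).hom y, ?_⟩
  have h1 := congr_arg (groupCohomology.cochainsIso₀ M).hom hy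
  rw [Iso.inv_hom_id_apply] at h1
  have h2 : M.tateNorm y = (groupCohomology.cochainsIso₀ M).inv
      (M.ρ.norm ((groupHomology.chainsIso₀ M).hom y)) := rfl
  rw [← h1, h2, Iso.inv_hom_id_apply]

theorem IsCohomologicallyTrivial.normsSurjectOntoInvariants {Q : Type} [Group Q] [Finite Q]
    {A : Type} [AddCommGroup A] [DistribMulAction Q A] (h : IsCohomologicallyTrivial Q A) :
    NormsSurjectOntoInvariants (Representation.ofDistribMulAction ℤ Q A) := by
  intro S _ a ha
  have := h S 0
  obtain ⟨b, hb⟩ := exists_norm_apply_eq_of_subsingleton_tateCohomology_zero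
    (Rep.ofDistribMulAction ℤ S A) (a := a) fun s => ha s s.2
  exact ⟨b, (Representation.norm_ofDistribMulAction_eq (k := ℤ) (G := S) (A := A) b).symm.trans hb⟩

/-- Norms are transitive: if T is the preimage of S, the norm from T is the norm from C followed by
the norm from S = T/C. -/
theorem NormsSurjectOntoInvariants.quotientToInvariants {G A : Type*} [Group G] [Finite G]
    [AddCommGroup A] {ρ : Representation ℤ G A} (h : NormsSurjectOntoInvariants ρ)
    (C : Subgroup G) [C.Normal] : NormsSurjectOntoInvariants (ρ.quotientToInvariants C) := by
  classical
  intro S _ a ha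
  let T : Subgroup G := S.comap (QuotientGroup.mk' C)
  have := Fintype.ofFinite T
  have := Fintype.ofFinite C
  obtain ⟨b, hb⟩ := h T a.1 fun t ht => congr_arg Subtype.val (ha _ ht)
  -- Each element of T is uniquely a chosen coset representative times an element of C.
  let e : S × C ≃ T :=
    { toFun x := ⟨x.1.1.out * x.2, by
        change ((x.1.1.out * x.2 : G) : G ⧸ C) ∈ S
        rw [QuotientGroup.mk_mul_of_mem _ x.2.2, QuotientGroup.out_eq']
        exact x.1.2⟩
      invFun t := (⟨(t.1 : G ⧸ C), t.2⟩,
        ⟨(t.1 : G ⧸ C).out⁻¹ * t.1, QuotientGroup.eq.1 (QuotientGroup.out_eq' _)⟩)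
      left_inv x := by
        have hx : ((x.1.1.out * x.2 : G) : G ⧸ C) = x.1.1 := by
          rw [QuotientGroup.mk_mul_of_mem _ x.2.2, QuotientGroup.out_eq']
        ext <;> simp [hx]
      right_inv t := by simp }
  have hc (c : C) : ρ c (∑ c : C, ρ c b) = ∑ c : C, ρ c b :=
    by simpa [Representation.norm] using Representation.self_norm_apply (ρ.comp C.subtype) c b
  refine ⟨⟨∑ c : C, ρ c b, hc⟩, Subtype.ext ?_⟩
  rw [← hb, ← e.sum_comp, Fintype.sum_prod_type, AddSubmonoidClass.coe_finsetSum]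
  refine Finset.sum_congr rfl fun s _ => ?_
  have hs : ρ.quotientToInvariants C s = ρ.toInvariants C s.1.out :=
    (congr_arg (ρ.quotientToInvariants C) (QuotientGroup.out_eq' s.1)).symm
  rw [hs]
  change ρ s.1.out (∑ c : C, ρ c b) = _
  simp [e, map_sum]

/-- The invariants of an element of order `p` are the multiples of `p`. -/
theorem NormsSurjectOntoInvariants.apply_eq_self_iff {p : ℕ} [hp : Fact p.Prime] {G A : Type*}
    [Group G] [Finite G] [AddCommGroup A] [Finite A] {ρ : Representation ℤ G A}
    (h : NormsSurjectOntoInvariants ρ) (hA : IsPGroup p (Multiplicative A)) (h3 : 3 ≤ p)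
    (hgen : ∃ s : Finset A, s.card ≤ p - 2 ∧ AddSubgroup.closure (s : Set A) = ⊤)
    {g : G} (hg : orderOf g = p) (a : A) : ρ g a = a ↔ ∃ b, p • b = a := by
  have hρ : ρ g ^ p = 1 := by rw [← map_pow, ← hg, pow_orderOf_eq_one, map_one]
  rw [← exists_geom_sum_apply_eq_iff hA h3 hgen hρ]
  constructor
  · intro hga
    have := Fintype.ofFinite (Subgroup.zpowers g)
    have hfix (s : G) (hs : s ∈ Subgroup.zpowers g) : ρ s a = a := by
      obtain ⟨i, rfl⟩ := mem_powers_iff_mem_zpowers.2 hs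
      rw [map_pow, Module.End.coe_pow]
      exact Function.iterate_fixed hga i
    obtain ⟨b, hb⟩ := h (Subgroup.zpowers g) a hfix
    refine ⟨b, ?_⟩
    rw [← hb, ← (finEquivZPowers (isOfFinOrder_of_finite g)).sum_comp, LinearMap.sum_apply, ← hg,
      ← Fin.sum_univ_eq_sum_range (fun i => (ρ g ^ i) b)]
    simp [finEquivZPowers_apply]
  · rintro ⟨b, rfl⟩
    have h1 := LinearMap.congr_fun (mul_geom_sum (ρ g) p) b
    rw [hρ, sub_self] at h1
    exact sub_eq_zero.1 h1

/-! ### Induction on the group order -/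

/-- A finite commutative `p`-group with cyclic quotient by a subgroup of order `p` is cyclic unless
it has a further element of order `p`. -/
theorem exists_orderOf_eq_notMem_of_not_isCyclic {p : ℕ} [hp : Fact p.Prime] {G : Type*} [Group G]
    [Finite G] (hG : IsPGroup p G) (hGc : ¬ IsCyclic G) {z : G} (hz : orderOf z = p)
    [(Subgroup.zpowers z).Normal] (hq : IsCyclic (G ⧸ Subgroup.zpowers z)) :
    ∃ h : G, orderOf h = p ∧ h ∉ Subgroup.zpowers z := by
  set C := Subgroup.zpowers z
  have hC : Nat.card C = p := (Nat.card_zpowers z).trans hz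
  obtain ⟨ybar, hy⟩ := hq.exists_generator
  obtain ⟨y, rfl⟩ := QuotientGroup.mk_surjective ybar
  -- Since y generates G modulo C, having z in ⟨y⟩ would give G = ⟨y⟩.
  have hzy : z ∉ Subgroup.zpowers y := by
    refine fun hzy => hGc ⟨y, fun x => ?_⟩
    obtain ⟨i, hi⟩ := hy x
    have h1 : (y ^ i)⁻¹ * x ∈ C := QuotientGroup.eq.1 (by simpa using hi)
    have h2 := (Subgroup.zpowers_le.2 hzy : C ≤ _) h1
    exact mul_inv_cancel_left (y ^ i) x ▸ mul_mem (Subgroup.zpow_mem_zpowers y i) h2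
  have hdisj : C ⊓ Subgroup.zpowers y = ⊥ := by
    by_contra hne
    have hcard : Nat.card (C ⊓ Subgroup.zpowers y : Subgroup G) = p := by
      refine ((Nat.dvd_prime hp.out).1
        (hC ▸ Subgroup.card_dvd_of_le inf_le_left)).resolve_left ?_
      rwa [Subgroup.card_eq_one]
    have : C ⊓ Subgroup.zpowers y = C :=
      Subgroup.eq_of_le_of_card_ge inf_le_left (by rw [hcard, hC])
    exact hzy (inf_eq_left.1 this (Subgroup.mem_zpowers z))
  have hy1 : y ≠ 1 := by
    rintro rfl
    refine hGc ⟨z, fun x => ?_⟩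
    obtain ⟨i, hi⟩ := hy x
    exact (QuotientGroup.eq_one_iff x).1 (hi.symm.trans (one_zpow i))
  have hdvd := hG.dvd_orderOf hy1
  have hh : orderOf (y ^ (orderOf y / p)) = p :=
    orderOf_pow_orderOf_div (orderOf_pos y).ne' hdvd
  refine ⟨_, hh, fun hm => ?_⟩
  have h1 : y ^ (orderOf y / p) = 1 := by
    have : y ^ (orderOf y / p) ∈ C ⊓ Subgroup.zpowers y := ⟨hm, Subgroup.npow_mem_zpowers y _⟩
    rwa [hdisj, Subgroup.mem_bot] at this
  rw [h1, orderOf_one] at hh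
  exact hp.out.one_lt.ne hh

theorem IsPGroup.exists_mem_center_orderOf_eq {p : ℕ} [hp : Fact p.Prime] {G : Type*} [Group G]
    [Finite G] [Nontrivial G] (hG : IsPGroup p G) : ∃ z ∈ Subgroup.center G, orderOf z = p := by
  have := hG.center_nontrivial
  obtain ⟨⟨c, hc⟩, hc1⟩ := exists_ne (1 : Subgroup.center G)
  have hc1 : c ≠ 1 := fun h => hc1 (Subtype.ext h)
  exact ⟨_, pow_mem hc _, orderOf_pow_orderOf_div (orderOf_pos c).ne' (hG.dvd_orderOf hc1)⟩

theorem subsingleton_of_forall_exists_nsmul_eq {p : ℕ} [Fact p.Prime] {A : Type*} [AddCommGroup A]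
    [Finite A] (hA : IsPGroup p (Multiplicative A)) (h : ∀ a : A, ∃ b, p • b = a) :
    Subsingleton A := by
  obtain ⟨m, hm⟩ := isNilpotent_of_forall_eq_nsmul hA (f := 1) fun a => (h a).imp fun _ => Eq.symm
  refine subsingleton_of_forall_eq 0 fun a => ?_
  simpa using LinearMap.congr_fun hm a

/-- A finite `p`-group with a nonzero module that is a finite `p`-group generated by `p - 2` elements,
and on which norms surject onto invariants, is cyclic. -/
theorem NormsSurjectOntoInvariants.isCyclic {p : ℕ} [hp : Fact p.Prime] {G A : Type*} [Group G]
    [Finite G] [AddCommGroup A] [Finite A] [Nontrivial A] {ρ : Representation ℤ G A}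
    (h : NormsSurjectOntoInvariants ρ) (hG : IsPGroup p G)
    (hA : IsPGroup p (Multiplicative A)) (h3 : 3 ≤ p)
    (hgen : ∃ s : Finset A, s.card ≤ p - 2 ∧ AddSubgroup.closure (s : Set A) = ⊤) :
    IsCyclic G := by
  induction hn : Nat.card G using Nat.strong_induction_on generalizing G A with
  | _ n ih =>
  subst hn
  rcases subsingleton_or_nontrivial G with _ | _
  · exact isCyclic_of_subsingleton
  obtain ⟨z, hzc, hz⟩ := hG.exists_mem_center_orderOf_eq
  set C := Subgroup.zpowers z
  have hC : C ≤ Subgroup.center G := Subgroup.zpowers_le.2 hzc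
  have hCn : C.Normal := ⟨fun c hc g => by
    rwa [Subgroup.mem_center_iff.1 (hC hc) g, mul_inv_cancel_right]⟩
  let B := Representation.invariants (ρ.comp C.subtype)
  have hB (a : A) : a ∈ B ↔ ∃ b, p • b = a := by
    rw [← h.apply_eq_self_iff hA h3 hgen hz]
    refine ⟨fun ha => ha ⟨z, Subgroup.mem_zpowers z⟩, ?_⟩
    rintro ha ⟨_, hs⟩
    obtain ⟨i, rfl⟩ := mem_powers_iff_mem_zpowers.2 hs
    change ρ (z ^ i) a = a
    rw [map_pow, Module.End.coe_pow]
    exact Function.iterate_fixed ha i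
  have hBp : IsPGroup p (Multiplicative B) :=
    hA.of_injective B.subtype.toAddMonoidHom.toMultiplicative Subtype.val_injective
  have hBgen : ∃ s : Finset B, s.card ≤ p - 2 ∧ AddSubgroup.closure (s : Set B) = ⊤ := by
    classical
    obtain ⟨s, hs, hsg⟩ := hgen
    let f : A →+ B := (nsmulAddMonoidHom p : A →+ A).codRestrict B fun a => (hB _).2 ⟨a, rfl⟩
    refine ⟨s.image f, Finset.card_image_le.trans hs, ?_⟩
    rw [Finset.coe_image, ← AddMonoidHom.map_closure, hsg, ← AddMonoidHom.range_eq_map,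
      AddMonoidHom.range_eq_top]
    rintro ⟨a, ha⟩
    obtain ⟨b, hb⟩ := (hB a).1 ha
    exact ⟨b, Subtype.ext hb⟩
  -- If B = 0, then z - 1 is injective on A; but it is also nilpotent, and A ≠ 0.
  have hBnt : Nontrivial B := by
    by_contra hBs
    rw [not_nontrivial_iff_subsingleton] at hBs
    obtain ⟨m, hm⟩ : IsNilpotent (ρ z - 1) := by
      refine (isNilpotent_of_forall_eq_nsmul hA
        (exists_sub_one_pow_apply_eq_nsmul hgen ?_)).of_pow
      rw [← map_pow, ← hz, pow_orderOf_eq_one, map_one]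
    have hinj : Function.Injective (ρ z - 1 : Module.End ℤ A) := by
      refine (injective_iff_map_eq_zero _).2 fun a ha => ?_
      have : a ∈ B := (hB a).2 ((h.apply_eq_self_iff hA h3 hgen hz a).1 (sub_eq_zero.1 ha))
      exact congr_arg Subtype.val (Subsingleton.elim (⟨a, this⟩ : B) 0)
    obtain ⟨a, ha⟩ := exists_ne (0 : A)
    refine ha ((hinj.iterate m) ?_)
    rw [← Module.End.coe_pow, hm]
    simp
  have hquot := h.quotientToInvariants C
  have hcard : Nat.card (G ⧸ C) < Nat.card G := by
    rw [Subgroup.card_eq_card_quotient_mul_card_subgroup C, Nat.card_zpowers, hz]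
    exact lt_mul_of_one_lt_right Nat.card_pos hp.out.one_lt
  have hcyc : IsCyclic (G ⧸ C) := ih _ hcard hquot (hG.to_quotient C) hBp hBgen rfl
  by_contra hGc
  obtain ⟨g, hg, hgC⟩ := exists_orderOf_eq_notMem_of_not_isCyclic hG hGc hz hcyc
  have hgq : orderOf (g : G ⧸ C) = p := by
    refine ((Nat.dvd_prime hp.out).1
      (hg ▸ orderOf_map_dvd (QuotientGroup.mk' C) g)).resolve_left fun h1 => hgC ?_
    exact (QuotientGroup.eq_one_iff g).1 (orderOf_eq_one_iff.1 h1)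
  refine not_subsingleton B (subsingleton_of_forall_exists_nsmul_eq hBp fun a => ?_)
  refine (hquot.apply_eq_self_iff hBp h3 hBgen hgq a).1 (Subtype.ext ?_)
  exact (h.apply_eq_self_iff hA h3 hgen hg a.1).2 ((hB a.1).1 a.2)

theorem theorem4 (p : ℕ) [Fact p.Prime]
    (Q : Type) [Group Q] [Finite Q] (hQ : IsPGroup p Q) (hQc : ¬ IsCyclic Q)
    (A : Type) [AddCommGroup A] [Finite A] [Nontrivial A] [DistribMulAction Q A]
    (hA : IsPGroup p (Multiplicative A))
    (hgen : ∃ s : Finset A, s.card ≤ p - 2 ∧ AddSubgroup.closure (s : Set A) = ⊤) :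
    ¬ IsCohomologicallyTrivial Q A := by
  intro h
  -- For p = 2 the bound p - 2 is 0, which would force A = 0.
  have h3 : 3 ≤ p := by
    by_contra hp
    obtain ⟨s, hs, hsg⟩ := hgen
    obtain rfl : s = ∅ := Finset.card_eq_zero.1 (by omega)
    rw [Finset.coe_empty, AddSubgroup.closure_empty] at hsg
    exact bot_ne_top hsg
  exact hQc (h.normsSurjectOntoInvariants.isCyclic hQ hA h3 hgen)
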